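/- An instance of \textsc{Diverse Knapsack} consists of a set $\mathcal P$ of $m$ items, a cost function $\mathtt c:\mathcal P\to\mathbb N$, a set $\mathcal V$ of $n$ voters, a utility function $\mathtt{util}_v:\mathcal P\to\mathbb N$ for every voter $v\in\mathcal V$, a budget $\mathtt b\in\mathbb N$ and a target $\mathtt{u_{tgt}}\in\mathbb N$ (with $0\in\mathbb N$). The question is whether there is a set $\mathcal Z\subseteq\mathcal P$ with $\sum_{p\in\mathcal Z}\mathtt c(p)\le\mathtt b$ and $\sum_{v\in\mathcal V}\max_{p\in\mathcal Z}\mathtt{util}_v(p)\ge\mathtt{u_{tgt}}$, where the maximum over the empty set is $0$. Let $\bar u=\sum_{v\in\mathcal V}\max_{p\in\mathcal P}\mathtt{util}_v(p)$. \textbf{Theorem.} \textsc{Diverse Knapsack} can be solved in $\mathcal O(2^n\,\mathrm{poly}(\bar u,\mathtt b,n,m))$ time. That is, there are a polynomial $q$ in four variables with coefficients in $\mathbb N$ and a single program for a random access machine (unit cost per instruction; the instructions are loading a constant, addition, truncated subtraction, indirect load and store, reading an input number at a given position, and jumps, unconditional or on zero) which, given the numbers $n,m,\mathtt b,\mathtt{u_{tgt}}$,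 the costs and the utilities of any instance, halts after at most $T=2^n\,q(\bar u,\mathtt b,n,m)$ steps with the correct answer, $1$ for yes and $0$ for no. Moreover, no number stored during the computation exceeds the maximum of $T$ and the largest input number. -/

import Mathlib

/-! ## The problem -/

/-- An instance of Diverse Knapsack with voters `Fin n` and items `Fin m`. -/
structure DKInstance where
  n : ℕ
  m : ℕ
  cost : Fin m → ℕ
  util : Fin n → Fin m → ℕ
  budget : ℕ
  target : ℕ

namespace DKInstance

/-- The satisfaction of voter `v` from the bundle `Z`: the largest utility that `v` assigns to an
item of `Z` (and `0` for the empty bundle). -/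
def sat (I : DKInstance) (v : Fin I.n) (Z : Finset (Fin I.m)) : ℕ :=
  Z.sup (I.util v)

/-- `I` is a yes-instance: some bundle of cost at most the budget gives the voters a total
satisfaction of at least the target. -/
def IsYes (I : DKInstance) : Prop :=
  ∃ Z : Finset (Fin I.m), ∑ p ∈ Z, I.cost p ≤ I.budget ∧ I.target ≤ ∑ v, I.sat v Z

/-- `ū`, the sum over the voters of the largest utility that the voter assigns to an item. -/
def ubar (I : DKInstance) : ℕ :=
  ∑ v, Finset.univ.sup (I.util v)

/-- The input as a sequence of numbers: `n`, `m`, the budget, the target, the `m` costs, and then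
voter by voter the `m` utilities. -/
def encode (I : DKInstance) : List ℕ :=
  [I.n, I.m, I.budget, I.target] ++ List.ofFn I.cost ++
    (List.ofFn fun v => List.ofFn (I.util v)).flatten

end DKInstance

/-! ## Random access machines

Registers `X 0, X 1, …` hold natural numbers and are initially `0`. The input is a read-only
sequence of numbers. Every instruction takes one step; the only arithmetic is addition and
truncated subtraction. -/

namespace RAM

inductive Instr
  /-- `X d := k` -/
  | const (d k : ℕ)
  /-- `X d := X s + X t` -/
  | add (d s t : ℕ)
  /-- `X d := X s - X t`, truncated at `0` -/
  | sub (d s t : ℕ)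
  /-- `X d := X (X s)` -/
  | load (d s : ℕ)
  /-- `X (X d) := X s` -/
  | store (d s : ℕ)
  /-- `X d :=` the input number at position `X s` (`0` beyond the end of the input) -/
  | read (d s : ℕ)
  /-- go to instruction `l` -/
  | jump (l : ℕ)
  /-- go to instruction `l` if `X s = 0` -/
  | jzero (s l : ℕ)

/-- A program is a finite sequence of instructions; it halts when the program counter leaves it. -/
abbrev Program := List Instr

structure Config where
  pc : ℕ
  X : ℕ → ℕ

def Config.init : Config := ⟨0, fun _ => 0⟩

/-- The effect of one instruction on the input `inp`. -/
def Instr.exec (inp : List ℕ) (c : Config) : Instr → Config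
  | .const d k => ⟨c.pc + 1, Function.update c.X d k⟩
  | .add d s t => ⟨c.pc + 1, Function.update c.X d (c.X s + c.X t)⟩
  | .sub d s t => ⟨c.pc + 1, Function.update c.X d (c.X s - c.X t)⟩
  | .load d s => ⟨c.pc + 1, Function.update c.X d (c.X (c.X s))⟩
  | .store d s => ⟨c.pc + 1, Function.update c.X (c.X d) (c.X s)⟩
  | .read d s => ⟨c.pc + 1, Function.update c.X d (inp.getD (c.X s) 0)⟩
  | .jump l => ⟨l, c.X⟩
  | .jzero s l => ⟨if c.X s = 0 then l else c.pc + 1, c.X⟩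

/-- One step of the machine; a configuration without a current instruction stays as it is. -/
def step (P : Program) (inp : List ℕ) (c : Config) : Config :=
  match P[c.pc]? with
  | some i => i.exec inp c
  | none => c

/-- The configuration after `t` steps. -/
def run (P : Program) (inp : List ℕ) (t : ℕ) : Config :=
  (step P inp)^[t] Config.init

def Config.Halted (P : Program) (c : Config) : Prop :=
  P.length ≤ c.pc

/-- On input `inp`, the program `P` halts after at most `T` steps, with `1` in register `0` if
`answer` holds and with `0` there otherwise, and no register ever holds a number that exceeds both
`T` and the largest input number (so that unit cost per instruction is realistic: words of
logarithmic length suffice). -/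
def DecidesWithin (P : Program) (inp : List ℕ) (answer : Prop) (T : ℕ) : Prop :=
  ∃ t ≤ T, (run P inp t).Halted P ∧
    (answer → (run P inp t).X 0 = 1) ∧ (¬ answer → (run P inp t).X 0 = 0) ∧
    ∀ k ≤ t, ∀ a, (run P inp k).X a ≤ max T (inp.foldr max 0)

end RAM

/-! Tabulate, for every set of voters and every amount of budget held back, the best total
satisfaction of these voters from an affordable bundle of the first `j` items: `(b + 1) * 2 ^ n`
entries. A bundle of the first `j + 1` items either omits item `j` or arises from a bundle that is
affordable with `c j` more held back. In the second case each voter takes the larger of the old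
satisfaction and the utility of the new item. Trying all sets of voters who switch to it would cost
a factor `3 ^ n`. But voters decide independently, so they can be treated one at a time: voter `k`
either keeps the old satisfaction or is removed from the set and contributes `u k j`. This makes `n`
sweeps over the table per item. The recurrence consists of `bestWith_zero`,
`bestWith_succ_of_testBit`, `bestWith_succ_of_not_testBit` and `best_succ`; by `isYes_iff` the entry
for all voters with nothing held back decides the instance.

The machine cannot multiply, divide or test bits. With the amount and the set packed into one index,
paying for an item shifts addresses by a multiple of `2 ^ n`, removing a voter subtracts `2 ^ k`,
and bits are recognised by a periodic counter. Time, correctness and the bound on registers are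
proved together in a Hoare logic (`Run`) for structured programs, and `Run.decidesWithin` transfers
the result to their machine code. Table entries never exceed `ū` (`best_le`, `bestWith_le`). -/

open Finset

namespace RAM

/-! ## Structured programs -/

/-- Structured programs: straight-line code, composition, branching on `X s ≠ 0`, and loops that
run while `X s ≠ 0`. -/
inductive Com
  | ops (l : List Instr)
  | seq (a b : Com)
  | ite (s : ℕ) (a b : Com)
  | loop (s : ℕ) (a : Com)

namespace Com

def size : Com → ℕ
  | ops l => l.length
  | seq a b => a.size + b.size
  | ite _ a b => a.size + b.size + 2
  | loop _ a => a.size + 2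

/-- The machine code of a structured program that is placed at position `o`. -/
def code : Com → ℕ → Program
  | ops l, _ => l
  | seq a b, o => a.code o ++ b.code (o + a.size)
  | ite s a b, o =>
      .jzero s (o + a.size + 2) :: (a.code (o + 1) ++
        .jump (o + a.size + 2 + b.size) :: b.code (o + a.size + 2))
  | loop s a, o => .jzero s (o + a.size + 2) :: (a.code (o + 1) ++ [.jump o])

theorem length_code (c : Com) (o : ℕ) : (c.code o).length = c.size := by
  induction c generalizing o with
  | ops l => rfl
  | seq a b iha ihb => simp [code, size, iha, ihb]
  | ite s a b iha ihb => simp [code, size, iha, ihb]; omega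
  | loop s a ih => simp [code, size, ih]

end Com

/-- The instructions `l` occupy the positions of `P` from `o` on. -/
def CodeAt (P : Program) (o : ℕ) (l : Program) : Prop :=
  ∀ i < l.length, P[o + i]? = l[i]?

theorem CodeAt.self (P : Program) : CodeAt P 0 P := fun i _ => by simp

theorem CodeAt.head {P : Program} {o : ℕ} {i : Instr} {l : Program}
    (h : CodeAt P o (i :: l)) : P[o]? = some i := by
  simpa using h 0 (by simp)

theorem CodeAt.tail {P : Program} {o : ℕ} {i : Instr} {l : Program}
    (h : CodeAt P o (i :: l)) : CodeAt P (o + 1) l := fun k hk => by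
  have := h (k + 1) (by simpa using hk)
  simpa [Nat.add_assoc, Nat.add_comm 1 k] using this

theorem CodeAt.left {P : Program} {o : ℕ} {l₁ l₂ : Program}
    (h : CodeAt P o (l₁ ++ l₂)) : CodeAt P o l₁ := fun k hk => by
  rw [h k (by simp; omega), List.getElem?_append_left hk]

theorem CodeAt.right {P : Program} {o : ℕ} {l₁ l₂ : Program}
    (h : CodeAt P o (l₁ ++ l₂)) : CodeAt P (o + l₁.length) l₂ := fun k hk => by
  rw [Nat.add_assoc, h (l₁.length + k) (by simp; omega),
    List.getElem?_append_right (by omega), Nat.add_sub_cancel_left]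

/-- The machine gets from `c` to `c'` in `t` steps, and all register contents on the way are
at most `M`. -/
def Reaches (P : Program) (inp : List ℕ) (M : ℕ) (c : Config) (t : ℕ) (c' : Config) : Prop :=
  (step P inp)^[t] c = c' ∧ ∀ k ≤ t, ∀ a, ((step P inp)^[k] c).X a ≤ M

/-! ### Executions with bounded registers -/

section Reaches

variable {P : Program} {inp : List ℕ} {M : ℕ}

theorem Reaches.zero {c : Config} (h : ∀ a, c.X a ≤ M) : Reaches P inp M c 0 c :=
  ⟨rfl, fun k hk a => by obtain rfl : k = 0 := by omega
                         exact h a⟩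

theorem Reaches.trans {c₁ c₂ c₃ : Config} {t₁ t₂ : ℕ} (h₁ : Reaches P inp M c₁ t₁ c₂)
    (h₂ : Reaches P inp M c₂ t₂ c₃) : Reaches P inp M c₁ (t₁ + t₂) c₃ := by
  refine ⟨?_, fun k hk a => ?_⟩
  · rw [Nat.add_comm, Function.iterate_add_apply, h₁.1, h₂.1]
  · rcases le_total k t₁ with h | h
    · exact h₁.2 k h a
    · obtain ⟨d, rfl⟩ := Nat.exists_eq_add_of_le h
      rw [Nat.add_comm, Function.iterate_add_apply, h₁.1]
      exact h₂.2 d (by omega) a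

theorem Reaches.bounded {c c' : Config} {t : ℕ} (h : Reaches P inp M c t c') (a : ℕ) :
    c'.X a ≤ M := by
  have := h.2 t le_rfl a
  rwa [h.1] at this

theorem Reaches.one {c c' : Config} {i : Instr} (hi : P[c.pc]? = some i)
    (he : i.exec inp c = c') (h : ∀ a, c.X a ≤ M) (h' : ∀ a, c'.X a ≤ M) :
    Reaches P inp M c 1 c' := by
  have hs : step P inp c = c' := by simp [step, hi, he]
  refine ⟨by simpa using hs, fun k hk a => ?_⟩
  obtain rfl | rfl : k = 0 ∨ k = 1 := by omega
  · exact h a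
  · simpa [hs] using h' a

end Reaches

/-- Started with register contents `X`, the program `c` ends after at most `τ` steps with register
contents that satisfy `Q`, and no register exceeds `M` unless one did so at the start. -/
def Run (inp : List ℕ) (M : ℕ) (c : Com) (τ : ℕ) (Q : (ℕ → ℕ) → Prop) (X : ℕ → ℕ) : Prop :=
  ∀ (P : Program) (o : ℕ), CodeAt P o (c.code o) → (∀ a, X a ≤ M) →
    ∃ t ≤ τ, ∃ X', Reaches P inp M ⟨o, X⟩ t ⟨o + c.size, X'⟩ ∧ Q X'

/-! ### Hoare rules with time and register bounds -/

section Rules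

variable {inp : List ℕ} {M : ℕ}

theorem Run.mono {c : Com} {τ τ' : ℕ} {Q Q' : (ℕ → ℕ) → Prop} {X : ℕ → ℕ}
    (h : Run inp M c τ Q X) (hτ : τ ≤ τ') (hQ : ∀ X', Q X' → Q' X') : Run inp M c τ' Q' X := by
  intro P o hc hX
  obtain ⟨t, ht, X', hr, hq⟩ := h P o hc hX
  exact ⟨t, ht.trans hτ, X', hr, hQ _ hq⟩

/-- Jump targets are absolute; since `Run` quantifies over the position of the code, the second
piece may start wherever the first one ends. -/
theorem Run.seq {a b : Com} {τ₁ τ₂ : ℕ} {Q : (ℕ → ℕ) → Prop} {X : ℕ → ℕ}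
    (h : Run inp M a τ₁ (Run inp M b τ₂ Q) X) : Run inp M (.seq a b) (τ₁ + τ₂) Q X := by
  intro P o hc hX
  obtain ⟨t₁, ht₁, X₁, hr₁, hq₁⟩ := h P o hc.left hX
  have hc' := hc.right
  rw [Com.length_code] at hc'
  obtain ⟨t₂, ht₂, X₂, hr₂, hq₂⟩ := hq₁ P _ hc' hr₁.bounded
  refine ⟨t₁ + t₂, by omega, X₂, ?_, hq₂⟩
  rw [Nat.add_assoc] at hr₂
  exact hr₁.trans hr₂

/-- The two extra steps are the test and, after the first branch only, the jump over the second. -/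
theorem Run.ite {s : ℕ} {a b : Com} {τ : ℕ} {Q : (ℕ → ℕ) → Prop} {X : ℕ → ℕ}
    (ha : X s ≠ 0 → Run inp M a τ Q X) (hb : X s = 0 → Run inp M b τ Q X) :
    Run inp M (.ite s a b) (τ + 2) Q X := by
  intro P o hc hX
  have hcb := hc.tail.right
  rw [Com.length_code] at hcb
  by_cases hs : X s = 0
  · have hcb' := hcb.tail
    rw [show o + 1 + a.size + 1 = o + a.size + 2 by omega] at hcb'
    obtain ⟨t, ht, X', hr, hq⟩ := hb hs P _ hcb' hX
    refine ⟨1 + t, by omega, X', ?_, hq⟩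
    have h1 : Reaches P inp M ⟨o, X⟩ 1 ⟨o + a.size + 2, X⟩ :=
      Reaches.one hc.head (by simp [Instr.exec, hs]) hX hX
    rw [show o + a.size + 2 + b.size = o + (Com.ite s a b).size by simp [Com.size]; omega] at hr
    exact h1.trans hr
  · obtain ⟨t, ht, X', hr, hq⟩ := ha hs P _ hc.tail.left hX
    refine ⟨1 + t + 1, by omega, X', ?_, hq⟩
    have h1 : Reaches P inp M ⟨o, X⟩ 1 ⟨o + 1, X⟩ :=
      Reaches.one hc.head (by simp [Instr.exec, hs]) hX hX
    have h2 : Reaches P inp M ⟨o + 1 + a.size, X'⟩ 1 ⟨o + (Com.ite s a b).size, X'⟩ :=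
      Reaches.one hcb.head (by simp [Instr.exec, Com.size]; omega) hr.bounded hr.bounded
    exact (h1.trans hr).trans h2

/-- A loop that makes exactly `k` passes, with the invariant `J i` before pass `i`. -/
theorem Run.loop {s : ℕ} {a : Com} {τ k : ℕ} {J : ℕ → (ℕ → ℕ) → Prop} {X : ℕ → ℕ}
    (h0 : J 0 X) (hpos : ∀ i < k, ∀ X, J i X → X s ≠ 0)
    (hbody : ∀ i < k, ∀ X, J i X → Run inp M a τ (J (i + 1)) X)
    (hend : ∀ X, J k X → X s = 0) :
    Run inp M (.loop s a) (k * (τ + 2) + 1) (J k) X := by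
  intro P o hc hX
  have hcj := hc.tail.right
  rw [Com.length_code] at hcj
  -- Each pass pays two steps besides the body, the test and the jump back; the test that leaves the
  -- loop is the final `+ 1`.
  have key : ∀ i ≤ k, ∃ t ≤ i * (τ + 2), ∃ X', Reaches P inp M ⟨o, X⟩ t ⟨o, X'⟩ ∧ J i X' := by
    intro i
    induction i with
    | zero => exact fun _ => ⟨0, by simp, X, Reaches.zero hX, h0⟩
    | succ i ih =>
      intro hi
      obtain ⟨t, ht, X₁, hr, hj⟩ := ih (by omega)
      have hs := hpos i (by omega) X₁ hj
      obtain ⟨t', ht', X₂, hr', hj'⟩ := hbody i (by omega) X₁ hj P _ hc.tail.left hr.bounded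
      have h1 : Reaches P inp M ⟨o, X₁⟩ 1 ⟨o + 1, X₁⟩ :=
        Reaches.one hc.head (by simp [Instr.exec, hs]) hr.bounded hr.bounded
      have h2 : Reaches P inp M ⟨o + 1 + a.size, X₂⟩ 1 ⟨o, X₂⟩ :=
        Reaches.one hcj.head (by simp [Instr.exec]) hr'.bounded hr'.bounded
      refine ⟨t + (1 + t' + 1), ?_, X₂, hr.trans ((h1.trans hr').trans h2), hj'⟩
      rw [Nat.succ_mul]
      omega
  obtain ⟨t, ht, X', hr, hj⟩ := key k le_rfl
  refine ⟨t + 1, by omega, X', hr.trans (Reaches.one hc.head ?_ hr.bounded hr.bounded), hj⟩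
  simp [Instr.exec, hend X' hj, Com.size]
  omega

/-- The weakest precondition of straight-line code. -/
def wpOps (inp : List ℕ) (M : ℕ) : List Instr → ((ℕ → ℕ) → Prop) → (ℕ → ℕ) → Prop
  | [], Q, X => Q X
  | .const d k :: l, Q, X => k ≤ M ∧ wpOps inp M l Q (Function.update X d k)
  | .add d s t :: l, Q, X => X s + X t ≤ M ∧ wpOps inp M l Q (Function.update X d (X s + X t))
  | .sub d s t :: l, Q, X => wpOps inp M l Q (Function.update X d (X s - X t))
  | .load d s :: l, Q, X => wpOps inp M l Q (Function.update X d (X (X s)))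
  | .store d s :: l, Q, X => wpOps inp M l Q (Function.update X (X d) (X s))
  | .read d s :: l, Q, X => wpOps inp M l Q (Function.update X d (inp.getD (X s) 0))
  | .jump _ :: _, _, _ => False
  | .jzero _ _ :: _, _, _ => False

theorem update_le {X : ℕ → ℕ} (hX : ∀ a, X a ≤ M) {d v : ℕ} (hv : v ≤ M) (a : ℕ) :
    Function.update X d v a ≤ M := by
  rw [Function.update_apply]
  split_ifs
  exacts [hv, hX a]

/-- Only constants and sums can create a number above `M`, so only they carry a side condition:
differences shrink, loads and stores move existing values, and reads are covered by `hinp`. -/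
theorem Run.ops (hinp : ∀ i, inp.getD i 0 ≤ M) {l : List Instr} {Q : (ℕ → ℕ) → Prop}
    {X : ℕ → ℕ} (h : wpOps inp M l Q X) : Run inp M (.ops l) l.length Q X := by
  suffices H : ∀ (P : Program) (o : ℕ), CodeAt P o l → (∀ a, X a ≤ M) →
      ∃ X', Reaches P inp M ⟨o, X⟩ l.length ⟨o + l.length, X'⟩ ∧ Q X' by
    intro P o hc hX
    obtain ⟨X', h⟩ := H P o hc hX
    exact ⟨l.length, le_rfl, X', h⟩
  induction l generalizing X with
  | nil => exact fun P o _ hX => ⟨X, Reaches.zero hX, h⟩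
  | cons i l ih =>
    intro P o hc hX
    have cont : ∀ d v : ℕ, v ≤ M → i.exec inp ⟨o, X⟩ = ⟨o + 1, Function.update X d v⟩ →
        wpOps inp M l Q (Function.update X d v) →
        ∃ X', Reaches P inp M ⟨o, X⟩ (i :: l).length ⟨o + (i :: l).length, X'⟩ ∧ Q X' := by
      intro d v hv he hw
      obtain ⟨X', hr, hq⟩ := ih hw P _ hc.tail (update_le hX hv)
      refine ⟨X', ?_, hq⟩
      have h1 : Reaches P inp M ⟨o, X⟩ 1 ⟨o + 1, Function.update X d v⟩ :=
        Reaches.one hc.head he hX (update_le hX hv)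
      have := h1.trans hr
      rwa [Nat.add_assoc, Nat.add_comm 1] at this
    cases i with
    | const d k => exact cont d k h.1 rfl h.2
    | add d s t => exact cont d _ h.1 rfl h.2
    | sub d s t => exact cont d _ ((Nat.sub_le _ _).trans (hX s)) rfl h
    | load d s => exact cont d _ (hX _) rfl h
    | store d s => exact cont _ _ (hX _) rfl h
    | read d s => exact cont d _ (hinp _) rfl h
    | jump l => exact h.elim
    | jzero s l => exact h.elim

/-- A structured program, placed at position `0`, as a decision procedure. -/
theorem Run.decidesWithin {c : Com} {τ T : ℕ} {A : Prop} (hτ : τ ≤ T)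
    (h : Run inp (max T (inp.foldr max 0)) c τ
      (fun X => (A → X 0 = 1) ∧ (¬ A → X 0 = 0)) (fun _ => 0)) :
    DecidesWithin (c.code 0) inp A T := by
  obtain ⟨t, ht, X', hr, hq⟩ := h _ 0 (CodeAt.self _) (fun _ => Nat.zero_le _)
  have hrun : run (c.code 0) inp t = ⟨0 + c.size, X'⟩ := hr.1
  refine ⟨t, ht.trans hτ, ?_, ?_, ?_, hr.2⟩
  · rw [hrun]
    simp [Config.Halted, Com.length_code]
  · rw [hrun]
    exact hq.1
  · rw [hrun]
    exact hq.2

end Rules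

end RAM

namespace DKInstance

/-! ## The dynamic program

Items and voters are natural numbers here, with costs `c` and utilities `u`. A table index `i`
encodes an amount `i / 2 ^ n` of the budget that must be left over, and the set of those voters
`v < n` for which bit `v` of `i` is set. -/

section Table

variable (c : ℕ → ℕ) (u : ℕ → ℕ → ℕ) (n b : ℕ)

/-- The bundles of items below `j` that, together with `d`, cost at most `b`. -/
def bundles (j d : ℕ) : Finset (Finset ℕ) :=
  {Z ∈ (range j).powerset | d + ∑ p ∈ Z, c p ≤ b}

/-- The largest satisfaction of the voters in `i` from a bundle of items below `j`. -/
def best (j i : ℕ) : ℕ :=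
  (bundles c b j (i / 2 ^ n)).sup fun Z => ∑ v ∈ range n with i.testBit v, Z.sup (u v)

/-- The same if item `j` has been bought in addition, but only voters below `k` may use it. -/
def bestWith (j k i : ℕ) : ℕ :=
  (bundles c b j (i / 2 ^ n + c j)).sup fun Z => ∑ v ∈ range n with i.testBit v,
    if v < k then max (Z.sup (u v)) (u v j) else Z.sup (u v)

variable {c u n b}

theorem empty_mem_bundles {j d : ℕ} (h : d ≤ b) : ∅ ∈ bundles c b j d := by
  simp [bundles, h]

/-- Hence registers that still hold their initial `0` already form the table for no items. -/
theorem best_zero (i : ℕ) : best c u n b 0 i = 0 := by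
  simp [best, bundles, Finset.filter_singleton]
  split_ifs <;> simp

theorem testBit_add_mul (i d v : ℕ) (hv : v < n) :
    (i + d * 2 ^ n).testBit v = i.testBit v := by
  have : (i + d * 2 ^ n) % 2 ^ n = i % 2 ^ n := Nat.add_mul_mod_self_right _ _ _
  have h := congrArg (Nat.testBit · v) this
  simp only [Nat.testBit_mod_two_pow, hv, decide_true, Bool.true_and] at h
  exact h

/-- Adding a multiple of `2 ^ n` raises the amount held back and leaves the voter bits alone. -/
theorem bestWith_zero (j i : ℕ) :
    bestWith c u n b j 0 i = best c u n b j (i + c j * 2 ^ n) := by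
  unfold bestWith best
  rw [Nat.add_mul_div_right _ _ (by positivity)]
  refine sup_congr rfl fun Z _ => ?_
  simp only [Nat.not_lt_zero, if_false]
  refine sum_congr ?_ fun _ _ => rfl
  ext v
  simp only [mem_filter, mem_range, and_congr_right_iff]
  intro hv
  rw [testBit_add_mul i _ v hv]

theorem bestWith_succ_of_not_testBit {j k i : ℕ} (h : i.testBit k = false) :
    bestWith c u n b j (k + 1) i = bestWith c u n b j k i := by
  unfold bestWith
  refine sup_congr rfl fun Z _ => sum_congr rfl fun v hv => ?_
  have hvk : v ≠ k := by
    rintro rfl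
    simp [h] at hv
  have : v < k + 1 ↔ v < k := by omega
  simp only [this]

theorem two_pow_le_of_testBit {i k : ℕ} (h : i.testBit k = true) : 2 ^ k ≤ i :=
  Nat.ge_two_pow_of_testBit h

/-- Bit `k` is set, so the subtraction causes no borrow and only clears this bit. -/
theorem testBit_sub_two_pow {i k v : ℕ} (h : i.testBit k = true) :
    (i - 2 ^ k).testBit v = (decide (v ≠ k) && i.testBit v) := by
  have hodd : i / 2 ^ k % 2 = 1 := by
    simpa [Nat.testBit_eq_decide_div_mod_eq] using h
  obtain ⟨q, hq⟩ : ∃ q, i / 2 ^ k = 2 * q + 1 := ⟨i / 2 ^ k / 2, by omega⟩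
  have hlt : i % 2 ^ k < 2 ^ k := Nat.mod_lt _ (by positivity)
  have e : i = 2 ^ k * (2 * q + 1) + i % 2 ^ k := by
    rw [← hq]
    exact (Nat.div_add_mod _ _).symm
  have e' : i - 2 ^ k = 2 ^ k * (2 * q) + i % 2 ^ k := by
    rw [Nat.mul_add, Nat.mul_one] at e
    omega
  rw [e']
  conv_rhs => rw [e]
  rw [Nat.testBit_two_pow_mul_add _ hlt, Nat.testBit_two_pow_mul_add _ hlt]
  by_cases hv : v < k
  · simp [hv, hv.ne]
  · obtain ⟨d, rfl⟩ := Nat.exists_eq_add_of_le (Nat.le_of_not_lt hv)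
    cases d with
    | zero => simp
    | succ d =>
      have h2 : (2 * q + 1) / 2 = q := by omega
      simp [Nat.testBit_add_one, h2]

theorem sub_two_pow_div {i k : ℕ} (hk : k < n) (h : i.testBit k = true) :
    (i - 2 ^ k) / 2 ^ n = i / 2 ^ n := by
  apply Nat.eq_of_testBit_eq
  intro v
  rw [Nat.testBit_div_two_pow, Nat.testBit_div_two_pow, testBit_sub_two_pow h]
  have : v + n ≠ k := by omega
  simp [this]

/-- The maximum in the summand of voter `k` splits the supremum in two; when `k` takes the new item,
the other summands are those of the set without `k`. Without `hi` there would be no bundle, and the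
right side could be `u k j` while the left is `0`. -/
theorem bestWith_succ_of_testBit {j k i : ℕ} (hk : k < n) (h : i.testBit k = true)
    (hi : i / 2 ^ n + c j ≤ b) :
    bestWith c u n b j (k + 1) i =
      max (bestWith c u n b j k i) (bestWith c u n b j k (i - 2 ^ k) + u k j) := by
  unfold bestWith
  rw [sub_two_pow_div hk h]
  set B := bundles c b j (i / 2 ^ n + c j) with hB
  have hne : B.Nonempty := ⟨∅, empty_mem_bundles hi⟩
  have hset : ({v ∈ range n | i.testBit v} : Finset ℕ) =
      insert k {v ∈ range n | (i - 2 ^ k).testBit v} := by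
    ext v
    simp only [mem_filter, mem_range, mem_insert, testBit_sub_two_pow h]
    by_cases hv : v = k
    · subst hv; simp [hk, h]
    · simp [hv]
  have hnot : k ∉ ({v ∈ range n | (i - 2 ^ k).testBit v} : Finset ℕ) := by
    simp [testBit_sub_two_pow h]
  set R := ({v ∈ range n | (i - 2 ^ k).testBit v} : Finset ℕ)
  rw [hset]
  have hR : ∀ Z : Finset ℕ, (∑ v ∈ R, if v < k + 1 then max (Z.sup (u v)) (u v j) else Z.sup (u v))
      = ∑ v ∈ R, if v < k then max (Z.sup (u v)) (u v j) else Z.sup (u v) := by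
    intro Z
    refine sum_congr rfl fun v hv => ?_
    have hvk : v ≠ k := fun e => hnot (e ▸ hv)
    have : v < k + 1 ↔ v < k := by omega
    simp only [this]
  simp only [sum_insert hnot, hR]
  simp only [lt_irrefl, if_false, Nat.lt_succ_self, if_true]
  -- Adding a constant commutes with the supremum only because `B` is nonempty; the empty supremum
  -- is `0`.
  have hadd : ∀ f : Finset ℕ → ℕ, B.sup f + u k j = B.sup fun Z => f Z + u k j := by
    intro f
    apply le_antisymm
    · obtain ⟨Z, hZ, e⟩ := exists_mem_eq_sup B hne f
      rw [e]
      exact le_sup (f := fun Z => f Z + u k j) hZ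
    · exact Finset.sup_le fun Z hZ => Nat.add_le_add_right (le_sup hZ) _
  rw [hadd, ← sup_sup]
  refine sup_congr rfl fun Z _ => ?_
  simp only [Pi.sup_apply]
  omega

theorem bundles_succ (j d : ℕ) :
    bundles c b (j + 1) d =
      bundles c b j d ∪ (bundles c b j (d + c j)).image (insert j) := by
  ext Z
  simp only [bundles, mem_filter, mem_powerset, mem_union, mem_image]
  constructor
  · rintro ⟨hZ, hc⟩
    by_cases hj : j ∈ Z
    · right
      refine ⟨Z.erase j, ⟨?_, ?_⟩, insert_erase hj⟩
      · intro p hp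
        have := hZ (mem_of_mem_erase hp)
        have := ne_of_mem_erase hp
        simp at *
        omega
      · rw [← add_sum_erase Z c hj] at hc
        omega
    · left
      refine ⟨fun p hp => ?_, hc⟩
      have h1 := hZ hp
      have : p ≠ j := fun e => hj (e ▸ hp)
      simp at *
      omega
  · rintro (⟨hZ, hc⟩ | ⟨W, ⟨hW, hc⟩, rfl⟩)
    · exact ⟨hZ.trans (range_subset_range.2 (Nat.le_succ j)), hc⟩
    · refine ⟨?_, ?_⟩
      · intro p hp
        rcases mem_insert.1 hp with rfl | hp
        · simp
        · have := hW hp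
          simp at *
          omega
      · have : j ∉ W := fun hj => by simpa using hW hj
        rw [sum_insert this]
        omega

/-- Once every voter below `n` may use item `j`, the summands are the satisfactions from the bundle
with `j` inserted. -/
theorem best_succ (j i : ℕ) :
    best c u n b (j + 1) i = max (best c u n b j i) (bestWith c u n b j n i) := by
  unfold best bestWith
  rw [bundles_succ, sup_union, sup_image]
  congr 1
  refine sup_congr rfl fun Z _ => sum_congr rfl fun v hv => ?_
  have : v < n := by simpa using (mem_filter.1 hv).1
  simp [this, max_comm]

/-- Indices at which item `j` is unaffordable may therefore be skipped when the two tables are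
merged. -/
theorem bestWith_eq_zero {j i : ℕ} (k : ℕ) (h : b < i / 2 ^ n + c j) :
    bestWith c u n b j k i = 0 := by
  have : bundles c b j (i / 2 ^ n + c j) = ∅ := by
    refine filter_eq_empty_iff.2 fun Z _ => ?_
    omega
  simp [bestWith, this]

theorem best_le {m j : ℕ} (hj : j ≤ m) (i : ℕ) :
    best c u n b j i ≤ ∑ v ∈ range n, (range m).sup (u v) := by
  refine Finset.sup_le fun Z hZ => ?_
  refine (sum_le_sum_of_subset (filter_subset _ _)).trans (sum_le_sum fun v _ => ?_)
  exact sup_mono ((mem_powerset.1 (mem_filter.1 hZ).1).trans (range_subset_range.2 hj))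

theorem bestWith_le {m j : ℕ} (hj : j < m) (k i : ℕ) :
    bestWith c u n b j k i ≤ ∑ v ∈ range n, (range m).sup (u v) := by
  refine Finset.sup_le fun Z hZ => ?_
  refine (sum_le_sum_of_subset (filter_subset _ _)).trans (sum_le_sum fun v _ => ?_)
  have h1 : Z.sup (u v) ≤ (range m).sup (u v) :=
    sup_mono ((mem_powerset.1 (mem_filter.1 hZ).1).trans (range_subset_range.2 hj.le))
  have h2 : u v j ≤ (range m).sup (u v) := le_sup (f := u v) (mem_range.2 hj)
  split_ifs
  · exact max_le h1 h2
  · exact h1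

/-- Bit `k` of `i` in terms of the remainder modulo `2 ^ (k + 1)`. -/
theorem testBit_iff_le_mod (i k : ℕ) : i.testBit k = true ↔ 2 ^ k ≤ i % 2 ^ (k + 1) := by
  rw [Nat.testBit_eq_decide_div_mod_eq, Nat.mod_pow_succ, decide_eq_true_iff]
  have h1 : i % 2 ^ k < 2 ^ k := Nat.mod_lt _ (by positivity)
  rcases Nat.mod_two_eq_zero_or_one (i / 2 ^ k) with h | h <;> simp [h, h1]

end Table

end DKInstance

namespace RAM

/-! ## The program

Registers `0` to `8` are constant until the last instruction: zero, the numbers of voters and items,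
the budget plus one, `2 ^ n`, the table size `L = (b + 1) * 2 ^ n`, one, and the addresses `32` and
`L + 32` of the two tables. -/

/-- `X d := X d + X 16 * X 4` -/
def mulCom (d : ℕ) : Com := .loop 16 (.ops [.add d d 4, .sub 16 16 6])

/-- Copies `X 18` cells from the address `X 20` on to the address `X 19`. -/
def copyCom : Com :=
  .loop 18 (.ops [.load 22 20, .store 19 22, .add 19 19 6, .add 20 20 6, .sub 18 18 6])

/-- In each of the `X 18` cells from `X 19` on whose index has the bit of weight `X 13`, takes the
maximum with the cell without this bit plus `X 17`. -/
def relaxCom : Com :=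
  .loop 18 (.seq (.ops [.add 21 21 6, .sub 22 21 13])
    (.seq (.ite 22 (.ops [.sub 22 19 13, .load 22 22, .add 22 22 17, .load 23 19, .sub 22 22 23,
        .add 23 23 22, .store 19 23]) (.ops []))
    (.seq (.ops [.sub 22 14 21])
    (.seq (.ite 22 (.ops []) (.ops [.const 21 0]))
      (.ops [.add 19 19 6, .sub 18 18 6])))))

/-- Replaces each of the `X 18` cells from `X 20` on by the maximum with the respective cell from
`X 19` on. -/
def mergeCom : Com :=
  .loop 18 (.ops [.load 22 19, .load 23 20, .sub 22 22 23, .add 23 23 22, .store 20 23,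
    .add 19 19 6, .add 20 20 6, .sub 18 18 6])

/-- Lets the voters one by one use the item at hand. -/
def votersCom : Com :=
  .loop 16 (.seq (.ops [.read 17 15, .add 14 13 13, .add 18 11 0, .add 19 8 0, .const 21 0])
    (.seq relaxCom (.ops [.add 13 14 0, .add 15 15 2, .sub 16 16 6])))

/-- Updates the table for one more item. -/
def itemCom : Com :=
  .seq (.ops [.read 22 10, .sub 16 3 22, .const 11 0])
    (.seq (mulCom 11)
    (.seq (.ops [.sub 12 5 11, .add 18 11 0, .add 19 8 0, .add 20 7 12])
    (.seq copyCom
    (.seq (.ops [.const 13 1, .add 15 10 2, .add 16 1 0])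
    (.seq votersCom
    (.seq (.ops [.add 18 11 0, .add 19 8 0, .add 20 7 0])
    (.seq mergeCom
      (.ops [.add 10 10 6, .sub 9 9 6]))))))))

/-- Sets up the constant registers. -/
def initCom : Com :=
  .seq (.ops [.const 6 1, .read 1 0, .read 2 6, .const 22 2, .read 3 22, .add 3 3 6, .const 4 1,
      .add 16 1 0])
    (.seq (.loop 16 (.ops [.add 4 4 4, .sub 16 16 6]))
    (.seq (.ops [.add 16 3 0])
    (.seq (mulCom 5)
      (.ops [.const 7 32, .add 8 7 5, .const 10 4, .add 9 2 0]))))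

/-- Decides Diverse Knapsack. -/
def knapsackCom : Com :=
  .seq initCom (.seq (.loop 9 itemCom)
    (.ops [.add 22 7 4, .sub 22 22 6, .load 22 22, .const 23 3, .read 23 23, .sub 23 23 22,
      .sub 0 6 23]))

/-! ### Correctness and cost of the elementary loops -/

section Loops

variable {inp : List ℕ} {M : ℕ}

theorem run_mulCom (hinp : ∀ i, inp.getD i 0 ≤ M) {d k : ℕ} {X : ℕ → ℕ} (hd4 : d ≠ 4)
    (hd6 : d ≠ 6) (hd16 : d ≠ 16) (h6 : X 6 = 1) (hd : X d = 0) (h16 : X 16 = k)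
    (hM : k * X 4 ≤ M) :
    Run inp M (mulCom d) (k * 4 + 1)
      (fun Y => Y d = k * X 4 ∧ ∀ a, a ≠ d → a ≠ 16 → Y a = X a) X := by
  refine (Run.loop (k := k) (J := fun i Y => Y 16 = k - i ∧ Y d = i * X 4 ∧
    ∀ a, a ≠ d → a ≠ 16 → Y a = X a) (τ := 2) ?_ ?_ ?_ ?_).mono le_rfl ?_
  · simp [h16, hd]
  · rintro i hi Y ⟨e, -⟩
    omega
  · rintro i hi Y ⟨e, ed, ef⟩
    refine Run.ops hinp ?_
    have e4 := ef 4 hd4.symm (by omega)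
    have e6 := ef 6 hd6.symm (by omega)
    have hle : (i + 1) * X 4 ≤ k * X 4 := Nat.mul_le_mul_right _ hi
    rw [Nat.succ_mul] at hle
    simp only [wpOps, Function.update_apply, e4, ed, e6, h6, e, hd6.symm, hd16.symm, hd16, if_true,
      if_false]
    refine ⟨by omega, by omega, by ring, fun a h1 h2 => by simp [h1, h2, ef]⟩
  · rintro Y ⟨e, -⟩
    omega
  · rintro Y ⟨-, h⟩
    exact h

/-- By `hs` the source block lies in the first table, which the writes to the second never touch. -/
theorem run_copyCom (hinp : ∀ i, inp.getD i 0 ≤ M) {L k s : ℕ} {X : ℕ → ℕ} (h6 : X 6 = 1)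
    (h18 : X 18 = k) (h19 : X 19 = L + 32) (h20 : X 20 = s + 32) (hs : s + k ≤ L)
    (hM : L + L + 32 ≤ M) :
    Run inp M copyCom (k * 7 + 1)
      (fun Y => (∀ a < 18, Y a = X a) ∧ (∀ a < L, Y (a + 32) = X (a + 32)) ∧
        ∀ a < k, Y (L + a + 32) = X (s + a + 32)) X := by
  refine (Run.loop (k := k) (J := fun i Y => (Y 18 = k - i ∧ Y 19 = L + i + 32 ∧
    Y 20 = s + i + 32) ∧ (∀ a < 18, Y a = X a) ∧ (∀ a < L, Y (a + 32) = X (a + 32)) ∧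
        ∀ a < i, Y (L + a + 32) = X (s + a + 32)) (τ := 5) ?_ ?_ ?_ ?_).mono le_rfl ?_
  · simp [h18, h19, h20]
  · rintro i hi Y ⟨⟨e, -⟩, -⟩
    omega
  · rintro i hi Y ⟨⟨e18, e19, e20⟩, er, ef, eg⟩
    refine Run.ops hinp ?_
    have e6 : Y 6 = 1 := (er 6 (by omega)).trans h6
    have es := ef (s + i) (by omega)
    simp [wpOps, Function.update_apply, e18, e19, e20, e6, es]
    refine ⟨by omega, by omega, ⟨by omega, by omega, by omega⟩, ?_, ?_, ?_⟩
    · intro a ha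
      rw [← er a ha]
      grind
    · intro a ha
      rw [← ef a ha]
      grind
    · intro a ha
      rcases Nat.lt_or_eq_of_le ha with h | rfl
      · rw [← eg a h]
        grind
      · simp
  · rintro Y ⟨⟨e, -⟩, -⟩
    omega
  · rintro Y ⟨-, h⟩
    exact h

/-- The maximum comes from truncated subtraction: `y + (x - y) = max x y`. -/
theorem run_mergeCom (hinp : ∀ i, inp.getD i 0 ≤ M) {L k : ℕ} {X : ℕ → ℕ} (h6 : X 6 = 1)
    (h18 : X 18 = k) (h19 : X 19 = L + 32) (h20 : X 20 = 32) (hk : k ≤ L)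
    (hM : L + L + 32 ≤ M) (hf : ∀ a < k, X (a + 32) ≤ M) (hg : ∀ a < k, X (L + a + 32) ≤ M) :
    Run inp M mergeCom (k * 10 + 1)
      (fun Y => (∀ a < 18, Y a = X a) ∧ (∀ a, k ≤ a → Y (a + 32) = X (a + 32)) ∧
        ∀ a < k, Y (a + 32) = max (X (a + 32)) (X (L + a + 32))) X := by
  refine (Run.loop (k := k) (J := fun i Y => (Y 18 = k - i ∧ Y 19 = L + i + 32 ∧
    Y 20 = i + 32) ∧ (∀ a < 18, Y a = X a) ∧ (∀ a, i ≤ a → Y (a + 32) = X (a + 32)) ∧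
        ∀ a < i, Y (a + 32) = max (X (a + 32)) (X (L + a + 32))) (τ := 8) ?_ ?_ ?_ ?_).mono le_rfl ?_
  · simp [h18, h19, h20]
  · rintro i hi Y ⟨⟨e, -⟩, -⟩
    omega
  · rintro i hi Y ⟨⟨e18, e19, e20⟩, er, ef, eg⟩
    refine Run.ops hinp ?_
    have e6 : Y 6 = 1 := (er 6 (by omega)).trans h6
    have es := ef i le_rfl
    have et := ef (L + i) (by omega)
    have hf := hf i hi
    have hg := hg i hi
    simp [wpOps, Function.update_apply, e18, e19, e20, e6, es, et]
    refine ⟨by omega, by omega, by omega, ⟨by omega, by omega⟩, ?_, ?_, ?_⟩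
    · intro a ha
      rw [← er a ha]
      grind
    · intro a ha
      rw [← ef a (by omega)]
      grind
    · intro a ha
      rcases Nat.lt_or_eq_of_le ha with h | rfl
      · rw [← eg a h]
        grind
      · simp
        omega
  · rintro Y ⟨⟨e, -⟩, -⟩
    omega
  · rintro Y ⟨-, h⟩
    exact h

/-- Register `21` counts cells modulo `2 ^ (q + 1)`, which reveals bit `q` of the index. The update
can be done in place, since a cell with this bit reads only a cell without it, and such cells never
change. -/
theorem run_relaxCom (hinp : ∀ i, inp.getD i 0 ≤ M) {L k q x : ℕ} {X : ℕ → ℕ} (h6 : X 6 = 1)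
    (h13 : X 13 = 2 ^ q) (h14 : X 14 = 2 ^ (q + 1)) (h17 : X 17 = x)
    (h18 : X 18 = k) (h19 : X 19 = L + 32) (h21 : X 21 = 0) (hk : k ≤ L)
    (hM : L + L + 32 ≤ M) (hq : 2 ^ (q + 1) ≤ M) (hg : ∀ a < k, X (L + a + 32) + x ≤ M) :
    Run inp M relaxCom (k * 19 + 1)
      (fun Y => (∀ a < 18, Y a = X a) ∧ (∀ a < L, Y (a + 32) = X (a + 32)) ∧
        ∀ a < k, Y (L + a + 32) = if a.testBit q then
          max (X (L + a + 32)) (X (L + (a - 2 ^ q) + 32) + x) else X (L + a + 32)) X := by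
  set g : ℕ → ℕ := fun a => if a.testBit q then
    max (X (L + a + 32)) (X (L + (a - 2 ^ q) + 32) + x) else X (L + a + 32) with hgdef
  refine (Run.loop (k := k) (J := fun i Y => (Y 18 = k - i ∧ Y 19 = L + i + 32 ∧
    Y 21 = i % 2 ^ (q + 1)) ∧ (∀ a < 18, Y a = X a) ∧ (∀ a < L, Y (a + 32) = X (a + 32)) ∧
        (∀ a, i ≤ a → Y (L + a + 32) = X (L + a + 32)) ∧
        ∀ a < i, Y (L + a + 32) = g a) (τ := 17) ?_ ?_ ?_ ?_).mono le_rfl ?_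
  · simp [h18, h19, h21]
  · rintro i hi Y ⟨⟨e, -⟩, -⟩
    omega
  · rintro i hi Y ⟨⟨e18, e19, e21⟩, er, ef, el, eg⟩
    have e6 : Y 6 = 1 := (er 6 (by omega)).trans h6
    have e13 : Y 13 = 2 ^ q := (er 13 (by omega)).trans h13
    have e14 : Y 14 = 2 ^ (q + 1) := (er 14 (by omega)).trans h14
    have e17 : Y 17 = x := (er 17 (by omega)).trans h17
    have hr : i % 2 ^ (q + 1) < 2 ^ (q + 1) := Nat.mod_lt _ (by positivity)
    have hbit := DKInstance.testBit_iff_le_mod i q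
    have hq0 : 0 < 2 ^ q := by positivity
    refine (Run.seq (τ₁ := 2) (τ₂ := 15) (Run.ops hinp ?_))
    simp only [wpOps, Function.update_apply, e6, e21, e13]
    refine ⟨by simpa using (by omega), ?_⟩
    refine Run.seq (τ₁ := 9) (τ₂ := 6) (Run.mono (τ := 7 + 2) (Q := fun Z => Z 18 = k - i ∧
      Z 19 = L + i + 32 ∧ Z 21 = i % 2 ^ (q + 1) + 1 ∧ (∀ a < 18, Z a = X a) ∧
      (∀ a < L, Z (a + 32) = X (a + 32)) ∧
      (∀ a, i + 1 ≤ a → Z (L + a + 32) = X (L + a + 32)) ∧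
      ∀ a < i + 1, Z (L + a + 32) = g a) (Run.ite ?_ ?_) le_rfl ?_)
    · intro h
      -- The counter is incremented before `2 ^ q` is subtracted, so a nonzero difference means `2 ^
      -- q ≤ i % 2 ^ (q + 1)`.
      have hb : i.testBit q = true := by
        rw [hbit]
        simp at h
        omega
      have hle := DKInstance.two_pow_le_of_testBit hb
      have hsub : L + i + 32 - 2 ^ q = L + (i - 2 ^ q) + 32 := by omega
      have hnb : (i - 2 ^ q).testBit q = false := by
        simp [DKInstance.testBit_sub_two_pow hb]
      -- This cell has been passed already, but lacks bit `q` and so kept its value.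
      have e1 : Y (L + (i - 2 ^ q) + 32) = X (L + (i - 2 ^ q) + 32) := by
        rw [eg _ (by omega), hgdef]
        simp [hnb]
      have e2 := el i le_rfl
      have b1 := hg (i - 2 ^ q) (by omega)
      have b2 := hg i hi
      refine Run.ops hinp ?_
      simp [wpOps, Function.update_apply, e18, e19, e13, e17, hsub, e1, e2]
      refine ⟨by omega, by omega, ?_, ?_, ?_, ?_⟩
      · intro a ha
        rw [← er a ha]
        grind
      · intro a ha
        rw [← ef a (by omega)]
        grind
      · intro a ha
        rw [← el a (by omega)]
        grind
      · intro a ha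
        rcases Nat.lt_or_eq_of_le ha with h | rfl
        · rw [← eg a h]
          grind
        · simp [hgdef, hb]
          omega
    · intro h
      have hb : i.testBit q = false := by
        rw [Bool.eq_false_iff, Ne, hbit]
        simp at h
        omega
      refine (Run.ops (l := []) hinp ?_).mono (Nat.zero_le _) fun _ h => h
      simp [wpOps, Function.update_apply, e18, e19]
      refine ⟨?_, ?_, ?_, ?_⟩
      · intro a ha
        rw [← er a ha]
        grind
      · intro a ha
        rw [← ef a (by omega)]
      · intro a ha
        rw [← el a (by omega)]
      · intro a ha
        rcases Nat.lt_or_eq_of_le ha with h | rfl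
        · rw [← eg a h]
        · simp [hgdef, hb, el]
    · rintro Z ⟨z18, z19, z21, zr, zf, zl, zg⟩
      have z6 : Z 6 = 1 := (zr 6 (by omega)).trans h6
      have z14 : Z 14 = 2 ^ (q + 1) := (zr 14 (by omega)).trans h14
      refine (Run.seq (τ₁ := 1) (τ₂ := 5) (Run.ops hinp ?_))
      simp only [wpOps, z14, z21]
      refine Run.seq (τ₁ := 3) (τ₂ := 2) (Run.mono (τ := 1 + 2) (Q := fun Z => Z 18 = k - i ∧
        Z 19 = L + i + 32 ∧ Z 21 = (i + 1) % 2 ^ (q + 1) ∧ (∀ a < 18, Z a = X a) ∧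
        (∀ a < L, Z (a + 32) = X (a + 32)) ∧
        (∀ a, i + 1 ≤ a → Z (L + a + 32) = X (L + a + 32)) ∧
        ∀ a < i + 1, Z (L + a + 32) = g a) (Run.ite ?_ ?_) le_rfl ?_)
      · intro h
        simp at h
        have hmod : (i + 1) % 2 ^ (q + 1) = i % 2 ^ (q + 1) + 1 := by
          rw [Nat.add_mod, Nat.mod_eq_of_lt (a := 1) (by omega), Nat.mod_eq_of_lt (by omega)]
        refine (Run.ops (l := []) hinp ?_).mono (Nat.zero_le _) fun _ h => h
        simp only [wpOps, Function.update_apply, hmod]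
        refine ⟨by simpa using z18, by simpa using z19, by simpa using z21, ?_, ?_, ?_, ?_⟩
        · intro a ha
          rw [← zr a ha]
          grind
        · simpa using zf
        · simpa using zl
        · simpa using zg
      · intro h
        simp at h
        have hmod : (i + 1) % 2 ^ (q + 1) = 0 := by
          rw [Nat.add_mod, Nat.mod_eq_of_lt (a := 1) (by rw [pow_succ]; omega),
            show i % 2 ^ (q + 1) + 1 = 2 ^ (q + 1) by omega, Nat.mod_self]
        refine Run.ops hinp ?_
        simp only [wpOps, Function.update_apply, hmod]
        refine ⟨by omega, by simpa using z18, by simpa using z19, by simp, ?_, ?_, ?_, ?_⟩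
        · intro a ha
          rw [← zr a ha]
          grind
        · simpa using zf
        · simpa using zl
        · simpa using zg
      · rintro W ⟨w18, w19, w21, wr, wf, wl, wg⟩
        have w6 : W 6 = 1 := (wr 6 (by omega)).trans h6
        refine Run.ops hinp ?_
        simp only [wpOps, Function.update_apply, w18, w19, w6]
        refine ⟨by omega, ⟨by simp; omega, by simp; omega, by simpa using w21⟩,
          ?_, ?_, ?_, ?_⟩
        · intro a ha
          rw [← wr a ha]
          grind
        · simpa using wf
        · simpa using wl
        · simpa using wg
  · rintro Y ⟨⟨e, -⟩, -⟩
    omega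
  · rintro Y ⟨-, h1, h2, -, h3⟩
    exact ⟨h1, h2, h3⟩

end Loops

end RAM

/-! ### Correctness and cost of the whole program -/

namespace RAM

open DKInstance

/-- The cost of item `j` as found in the input. -/
def costs (inp : List ℕ) (j : ℕ) : ℕ := inp.getD (4 + j) 0

/-- The utility of item `j` for voter `v` as found in the input with `m` items. -/
def utils (inp : List ℕ) (m v j : ℕ) : ℕ := inp.getD (4 + j + m + v * m) 0

/-- The contents of the constant registers. -/
structure Fixed (n m b : ℕ) (X : ℕ → ℕ) : Prop where
  r0 : X 0 = 0
  r1 : X 1 = n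
  r2 : X 2 = m
  r3 : X 3 = b + 1
  r4 : X 4 = 2 ^ n
  r5 : X 5 = (b + 1) * 2 ^ n
  r6 : X 6 = 1
  r7 : X 7 = 32
  r8 : X 8 = (b + 1) * 2 ^ n + 32

theorem Fixed.congr {n m b : ℕ} {X Y : ℕ → ℕ} (h : Fixed n m b X) (hY : ∀ a < 9, Y a = X a) :
    Fixed n m b Y where
  r0 := (hY 0 (by omega)).trans h.r0
  r1 := (hY 1 (by omega)).trans h.r1
  r2 := (hY 2 (by omega)).trans h.r2
  r3 := (hY 3 (by omega)).trans h.r3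
  r4 := (hY 4 (by omega)).trans h.r4
  r5 := (hY 5 (by omega)).trans h.r5
  r6 := (hY 6 (by omega)).trans h.r6
  r7 := (hY 7 (by omega)).trans h.r7
  r8 := (hY 8 (by omega)).trans h.r8

/-- Numbers up to `M` suffice for the computation. -/
structure Enough (inp : List ℕ) (n m b M : ℕ) : Prop where
  input : ∀ i, inp.getD i 0 ≤ M
  table : (b + 1) * 2 ^ n + (b + 1) * 2 ^ n + 32 ≤ M
  util : 2 * ∑ v ∈ range n, (range m).sup (utils inp m v) ≤ M
  pos : 4 + m + m + n * m ≤ M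

section Item

variable {inp : List ℕ} {n m b M : ℕ}

theorem Enough.two_pow (h : Enough inp n m b M) {k : ℕ} (hk : k ≤ n) : 2 ^ k ≤ M := by
  have h1 : 2 ^ k ≤ 2 ^ n := Nat.pow_le_pow_right (by omega) hk
  have h2 : 1 * 2 ^ n ≤ (b + 1) * 2 ^ n := Nat.mul_le_mul_right _ (by omega)
  have := h.table
  omega

/-- With the next lemma: the indices at which a further cost `d` is affordable form an initial
segment, which is empty if `d > b` by truncation. -/
theorem le_of_lt_mul {i d : ℕ} (hi : i < (b + 1 - d) * 2 ^ n) : i / 2 ^ n + d ≤ b := by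
  have : i / 2 ^ n < b + 1 - d := (Nat.div_lt_iff_lt_mul (by positivity)).2 hi
  generalize i / 2 ^ n = e at *
  omega

theorem lt_of_mul_le {i d : ℕ} (hi : (b + 1 - d) * 2 ^ n ≤ i) : b < i / 2 ^ n + d := by
  have := (Nat.le_div_iff_mul_le (by positivity : 0 < 2 ^ n)).2 hi
  omega

theorem run_votersCom (hE : Enough inp n m b M) {j : ℕ} (hj : j < m) {X : ℕ → ℕ}
    (hX : Fixed n m b X)
    (h11 : X 11 = (b + 1 - costs inp j) * 2 ^ n) (h13 : X 13 = 1) (h15 : X 15 = 4 + j + m)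
    (h16 : X 16 = n)
    (hg : ∀ a < (b + 1 - costs inp j) * 2 ^ n, X ((b + 1) * 2 ^ n + a + 32) =
      bestWith (costs inp) (utils inp m) n b j 0 a) :
    Run inp M votersCom (n * ((b + 1) * 2 ^ n * 19 + 11) + 1)
      (fun Y => (∀ a < 13, Y a = X a) ∧
        (∀ a < (b + 1) * 2 ^ n, Y (a + 32) = X (a + 32)) ∧
        ∀ a < (b + 1 - costs inp j) * 2 ^ n, Y ((b + 1) * 2 ^ n + a + 32) =
          bestWith (costs inp) (utils inp m) n b j n a) X := by
  have hlimL : (b + 1 - costs inp j) * 2 ^ n ≤ (b + 1) * 2 ^ n :=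
    Nat.mul_le_mul_right _ (Nat.sub_le _ _)
  have hlim : ∀ a < (b + 1 - costs inp j) * 2 ^ n, a / 2 ^ n + costs inp j ≤ b :=
    fun a ha => le_of_lt_mul ha
  have hM := hE.table
  generalize (b + 1 - costs inp j) * 2 ^ n = k at *
  have h8 := hX.r8
  generalize hL : (b + 1) * 2 ^ n = L at *
  refine (Run.loop (k := n) (J := fun q Y => (Y 13 = 2 ^ q ∧ Y 15 = 4 + j + m + q * m ∧
    Y 16 = n - q) ∧ (∀ a < 13, Y a = X a) ∧ (∀ a < L, Y (a + 32) = X (a + 32)) ∧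
        ∀ a < k, Y (L + a + 32) = bestWith (costs inp) (utils inp m) n b j q a)
        (τ := L * 19 + 9) ?_ ?_ ?_ ?_).mono le_rfl ?_
  · simpa [h13, h15, h16] using hg
  · rintro i hi Y ⟨⟨-, -, e⟩, -⟩
    omega
  · rintro q hq Y ⟨⟨e13, e15, e16⟩, er, ef, eg⟩
    have hY : Fixed n m b Y := hX.congr fun a ha => er a (by omega)
    have e8 : Y 8 = L + 32 := (er 8 (by omega)).trans h8
    have e11 : Y 11 = k := (er 11 (by omega)).trans h11
    have hpow := hE.two_pow (k := q + 1) hq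
    have hu : utils inp m q j ≤ ∑ v ∈ range n, (range m).sup (utils inp m v) :=
      (le_sup (f := utils inp m q) (mem_range.2 hj)).trans
        (single_le_sum (f := fun v => (range m).sup (utils inp m v))
          (fun _ _ => Nat.zero_le _) (mem_range.2 hq))
    have hqm : (q + 1) * m ≤ n * m := Nat.mul_le_mul_right _ hq
    have hpos := hE.pos
    have hutil := hE.util
    rw [show L * 19 + 9 = 5 + (L * 19 + 4) by omega]
    refine Run.seq (τ₁ := 5) (τ₂ := L * 19 + 4) (Run.ops (l := [_, _, _, _, _]) hE.input ?_)
    simp [wpOps, e13, e15, e11, e8, hY.r0]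
    refine ⟨by rw [pow_succ] at hpow; omega, by omega, by omega, ?_⟩
    refine Run.seq (τ₁ := L * 19 + 1) (τ₂ := 3) (Run.mono (run_relaxCom (L := L) (k := k)
      (q := q) (x := utils inp m q j) hE.input ?_ ?_ ?_ ?_ ?_ ?_ ?_ hlimL hM hpow ?_) (by gcongr) ?_)
    · simp [hY.r6]
    · simp [e13]
    · simp [pow_succ]; omega
    · simp [utils]
    · simp
    · simp
    · simp
    -- Table entry and utility are each at most `ū`; their sum explains the factor `2` in
    -- `Enough.util`.
    · intro a ha
      have := bestWith_le (c := costs inp) (u := utils inp m) (n := n) (b := b) hj q a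
      simp [eg a ha]
      omega
    · rintro Z ⟨zr, zf, zg⟩
      have zY : ∀ a < 14, Z a = Y a := fun a ha => by
        rw [zr a (by omega)]
        grind
      have hZ : Fixed n m b Z := hY.congr fun a ha => zY a (by omega)
      have z14 : Z 14 = 2 ^ (q + 1) := by
        rw [zr 14 (by omega)]
        simp [pow_succ]; omega
      have z15 : Z 15 = 4 + j + m + q * m := by
        rw [zr 15 (by omega)]
        simp [e15]
      have z16 : Z 16 = n - q := by
        rw [zr 16 (by omega)]
        simp [e16]
      refine Run.ops hE.input ?_
      rw [Nat.succ_mul] at hqm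
      simp [wpOps, Function.update_apply, z14, z15, z16, hZ.r0, hZ.r2, hZ.r6]
      refine ⟨hpow, by omega, ⟨by ring, by omega⟩, ?_, ?_, ?_⟩
      · intro a ha
        rw [← er a ha, ← zY a (by omega)]
        grind
      · intro a ha
        rw [zf a ha, ← ef a ha]
        simp
      · intro a ha
        rw [zg a ha]
        simp only [Function.update_apply]
        simp only [Nat.reduceEqDiff, if_false]
        rcases hb : a.testBit q with _ | _
        · rw [bestWith_succ_of_not_testBit hb]
          simp [eg a ha]
        · rw [bestWith_succ_of_testBit hq hb (hlim a ha)]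
          simp [eg a ha, eg (a - 2 ^ q) (by omega)]
  · rintro Y ⟨⟨-, -, e⟩, -⟩
    omega
  · rintro Y ⟨-, h⟩
    exact h

/-- The state before item `j` is handled. -/
structure Stage (inp : List ℕ) (n m b j : ℕ) (X : ℕ → ℕ) : Prop where
  fixed : Fixed n m b X
  rest : X 9 = m - j
  pos : X 10 = 4 + j
  table : ∀ a < (b + 1) * 2 ^ n, X (a + 32) = best (costs inp) (utils inp m) n b j a

/-- The shifted copy realises `bestWith_zero` in the second table, the voter sweeps turn it into
`bestWith` for all `n` voters, and the merge is `best_succ`. The sweeps dominate the cost. -/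
theorem run_itemCom (hE : Enough inp n m b M) {j : ℕ} (hj : j < m) {X : ℕ → ℕ}
    (hX : Stage inp n m b j X) :
    Run inp M itemCom ((b + 1) * 2 ^ n * (19 * n + 21) + 11 * n + 19)
      (Stage inp n m b (j + 1)) X := by
  have hM := hE.table
  have hpos := hE.pos
  have hutil := hE.util
  have h10 := hX.pos
  have h9 := hX.rest
  have hF := hX.fixed
  have hlimL : (b + 1 - costs inp j) * 2 ^ n ≤ (b + 1) * 2 ^ n :=
    Nat.mul_le_mul_right _ (Nat.sub_le _ _)
  have hb1 : b + 1 - costs inp j ≤ (b + 1) * 2 ^ n :=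
    (Nat.sub_le _ _).trans (Nat.le_mul_of_pos_right _ (by positivity))
  set k := (b + 1 - costs inp j) * 2 ^ n with hk
  set L := (b + 1) * 2 ^ n with hL
  have htime : 3 + (L * 4 + 1 + (4 + (L * 7 + 1 + (3 + (n * (L * 19 + 11) + 1 +
      (3 + (L * 10 + 1 + 2))))))) = L * (19 * n + 21) + 11 * n + 19 := by ring
  rw [← htime]
  refine Run.seq (Run.ops (l := [_, _, _]) hE.input ?_)
  simp only [wpOps]
  refine ⟨by omega, ?_⟩
  refine Run.seq (Run.mono (run_mulCom (k := b + 1 - costs inp j) hE.input (by omega) (by omega)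
    (by omega) ?_ ?_ ?_ ?_) (by omega) ?_)
  · simp [hF.r6]
  · simp
  · simp [h10, hF.r3, costs]
  · simp [hF.r4]
    omega
  rintro Y ⟨e11, er⟩
  have eX : ∀ a < 11, Y a = X a := fun a ha => by
    rw [er a (by omega) (by omega)]
    grind
  have eT : ∀ a, Y (a + 32) = X (a + 32) := fun a => by
    rw [er _ (by omega) (by omega)]
    simp
  replace e11 : Y 11 = k := by simpa [hF.r4] using e11
  have hY : Fixed n m b Y := hF.congr fun a ha => eX a (by omega)
  clear er
  refine Run.seq (Run.ops (l := [_, _, _, _]) hE.input ?_)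
  simp [wpOps, e11, hY.r0, hY.r5, hY.r7, hY.r8, ← hL]
  refine ⟨by omega, by omega, by omega, ?_⟩
  refine Run.seq (Run.mono (run_copyCom (L := L) (k := k) (s := L - k) hE.input ?_ ?_ ?_ ?_
    (by omega) hM) (by omega) ?_)
  · simp [hY.r6]
  · simp
  · simp
  · simp; omega
  rintro Z ⟨zr, zf, zg⟩
  have zX : ∀ a < 11, Z a = X a := fun a ha => by
    rw [zr a (by omega), ← eX a ha]
    grind
  have z11 : Z 11 = k := by
    rw [zr _ (by omega)]
    simp [e11]
  have zT : ∀ a < L, Z (a + 32) = best (costs inp) (utils inp m) n b j a := fun a ha => by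
    rw [zf a ha, ← hX.table a ha, ← eT a]
    simp
  have zG : ∀ a < k, Z (L + a + 32) = bestWith (costs inp) (utils inp m) n b j 0 a := by
    intro a ha
    -- A cell to copy exists only if the item is affordable; then the offset `L - k` is not
    -- distorted by truncation.
    have hc : costs inp j ≤ b := (Nat.le_add_left _ _).trans (le_of_lt_mul ha)
    have hoff : L - k = costs inp j * 2 ^ n := by
      rw [hL, hk, ← Nat.sub_mul]
      congr 1
      omega
    rw [zg a ha, bestWith_zero, ← hoff, Nat.add_comm a, ← hX.table _ (by omega), ← eT]
    simp
  have hZ : Fixed n m b Z := hF.congr fun a ha => zX a (by omega)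
  clear zr zf zg
  refine Run.seq (Run.ops (l := [_, _, _]) hE.input ?_)
  simp [wpOps, zX 10 (by omega), h10, hZ.r0, hZ.r1, hZ.r2]
  have hn := hE.two_pow le_rfl
  have hn' := Nat.lt_two_pow_self (n := n)
  refine ⟨by omega, by omega, by omega, ?_⟩
  refine Run.seq (Run.mono (run_votersCom hE hj ?_ ?_ ?_ ?_ ?_ ?_) le_rfl ?_)
  · exact hZ.congr fun a ha => by grind
  · simp [z11, hk]
  · simp
  · simp
  · simp
  · intro a ha
    simpa using zG a ha
  rintro V ⟨vr, vf, vg⟩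
  rw [← hk, ← hL] at vg
  have vX : ∀ a < 11, V a = X a := fun a ha => by
    rw [vr a (by omega), ← zX a ha]
    grind
  have v11 : V 11 = k := by
    rw [vr _ (by omega)]
    simp [z11]
  have vT : ∀ a < L, V (a + 32) = best (costs inp) (utils inp m) n b j a := fun a ha => by
    rw [vf a ha, ← zT a ha]
    simp
  have hV : Fixed n m b V := hF.congr fun a ha => vX a (by omega)
  clear vr vf
  refine Run.seq (Run.ops (l := [_, _, _]) hE.input ?_)
  simp [wpOps, v11, hV.r0, hV.r7, hV.r8, ← hL]
  refine ⟨by omega, by omega, by omega, ?_⟩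
  refine Run.seq (Run.mono (run_mergeCom (L := L) (k := k) hE.input ?_ ?_ ?_ ?_ hlimL hM ?_ ?_)
    (by omega) ?_)
  · simp [hV.r6]
  · simp
  · simp
  · simp
  · intro a ha
    have := best_le (c := costs inp) (u := utils inp m) (n := n) (b := b) hj.le a
    simp [vT a (by omega)]
    omega
  · intro a ha
    have := bestWith_le (c := costs inp) (u := utils inp m) (n := n) (b := b) hj n a
    simp [vg a ha]
    omega
  rintro W ⟨wr, wf, wg⟩
  have wX : ∀ a < 11, W a = X a := fun a ha => by
    rw [wr a (by omega), ← vX a ha]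
    grind
  have hW : Fixed n m b W := hF.congr fun a ha => wX a (by omega)
  refine Run.ops hE.input ?_
  simp [wpOps, wX 9 (by omega), wX 10 (by omega), h9, h10, hW.r6]
  refine ⟨by omega, hW.congr fun a ha => by grind, by simp; omega, by simp; omega, fun a ha => ?_⟩
  rw [best_succ]
  by_cases hak : a < k
  · have := wg a hak
    simp at this
    simp [this, vT a ha, vg a hak]
  · have := wf a (by omega)
    simp at this
    simp [this, vT a ha, bestWith_eq_zero (c := costs inp) (u := utils inp m) n
      (lt_of_mul_le (Nat.le_of_not_lt hak))]

theorem run_initCom (hE : Enough inp n m b M) (h0 : inp.getD 0 0 = n) (h1 : inp.getD 1 0 = m)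
    (h2 : inp.getD 2 0 = b) :
    Run inp M initCom (4 * n + 4 * b + 19) (Stage inp n m b 0) (fun _ => 0) := by
  have hM := hE.table
  have hpos := hE.pos
  have hb1 : b + 1 ≤ (b + 1) * 2 ^ n := Nat.le_mul_of_pos_right _ (by positivity)
  have hn := hE.two_pow le_rfl
  have hn' := Nat.lt_two_pow_self (n := n)
  rw [show 4 * n + 4 * b + 19 = 8 + (n * 4 + 1 + (1 + ((b + 1) * 4 + 1 + 4))) by ring]
  set L := (b + 1) * 2 ^ n with hL
  refine Run.seq (Run.ops (l := [_, _, _, _, _, _, _, _]) hE.input ?_)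
  simp [-List.getD_eq_getElem?_getD, wpOps, h0, h1, h2]
  refine ⟨by omega, by omega, by omega, by omega, by omega, ?_⟩
  refine Run.seq (Run.mono (Run.loop (k := n) (J := fun i Y => Y 16 = n - i ∧ Y 4 = 2 ^ i ∧
    Y 0 = 0 ∧ Y 1 = n ∧ Y 2 = m ∧ Y 3 = b + 1 ∧ Y 5 = 0 ∧ Y 6 = 1 ∧ ∀ a, Y (a + 32) = 0)
    (τ := 2) ?_ ?_ ?_ ?_) le_rfl ?_)
  · simp
  · rintro i hi Y ⟨e, -⟩
    omega
  · rintro i hi Y ⟨e16, e4, e0, e1, e2, e3, e5, e6, eT⟩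
    have hpow := hE.two_pow (k := i + 1) hi
    rw [pow_succ] at hpow
    refine Run.ops hE.input ?_
    simp [wpOps, e16, e4, e0, e1, e2, e3, e5, e6, eT, pow_succ]
    omega
  · rintro Y ⟨e, -⟩
    omega
  rintro Y ⟨-, e4, e0, e1, e2, e3, e5, e6, eT⟩
  refine Run.seq (Run.ops (l := [_]) hE.input ?_)
  simp only [wpOps, e3, e0]
  refine ⟨by omega, ?_⟩
  refine Run.seq (Run.mono (run_mulCom (k := b + 1) hE.input (by omega) (by omega)
    (by omega) ?_ ?_ ?_ ?_) le_rfl ?_)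
  · simp [e6]
  · simp [e5]
  · simp
  · simp [e4]
    omega
  rintro Z ⟨z5, zr⟩
  replace z5 : Z 5 = L := by simpa [e4] using z5
  have zY : ∀ a, a ≠ 5 → a ≠ 16 → Z a = Y a := fun a h h' => by
    rw [zr a h h']
    simp [h']
  refine Run.ops hE.input ?_
  have z0 : Z 0 = 0 := by rw [zY _ (by omega) (by omega), e0]
  have z1 : Z 1 = n := by rw [zY _ (by omega) (by omega), e1]
  have z2 : Z 2 = m := by rw [zY _ (by omega) (by omega), e2]
  have z3 : Z 3 = b + 1 := by rw [zY _ (by omega) (by omega), e3]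
  have z4 : Z 4 = 2 ^ n := by rw [zY _ (by omega) (by omega), e4]
  have z6 : Z 6 = 1 := by rw [zY _ (by omega) (by omega), e6]
  simp [wpOps, z5, z2, z0]
  refine ⟨by omega, by omega, by omega, by omega, ⟨?_, ?_, ?_, ?_, ?_, ?_, ?_, ?_, ?_⟩, ?_, ?_, ?_⟩
  iterate 11 simp [z0, z1, z2, z3, z4, z5, z6, hL, Nat.add_comm]
  intro a _
  simp [best_zero, zY, eT]

theorem run_knapsackCom (hE : Enough inp n m b M) (h0 : inp.getD 0 0 = n)
    (h1 : inp.getD 1 0 = m) (h2 : inp.getD 2 0 = b) :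
    Run inp M knapsackCom
      (4 * n + 4 * b + 19 + (m * ((b + 1) * 2 ^ n * (19 * n + 21) + 11 * n + 19 + 2) + 1 + 7))
      (fun X => X 0 = 1 - (inp.getD 3 0 - best (costs inp) (utils inp m) n b m (2 ^ n - 1)))
      (fun _ => 0) := by
  refine Run.seq ((run_initCom hE h0 h1 h2).mono le_rfl fun Y hY => ?_)
  refine Run.seq ((Run.loop (J := Stage inp n m b) (k := m) hY ?_ ?_ ?_).mono le_rfl
    fun Z hZ => ?_)
  · intro i hi X hX
    have := hX.rest
    omega
  · exact fun i hi X hX => run_itemCom hE hi hX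
  · intro X hX
    have := hX.rest
    omega
  have hM := hE.table
  have hp : 0 < 2 ^ n := by positivity
  have hle : 1 * 2 ^ n ≤ (b + 1) * 2 ^ n := Nat.mul_le_mul_right _ (by omega)
  -- Index `2 ^ n - 1` stands for all voters and nothing held back.
  have ht := hZ.table (2 ^ n - 1) (by omega)
  have haddr : 32 + 2 ^ n - 1 = 2 ^ n - 1 + 32 := by omega
  refine Run.ops hE.input ?_
  simp [wpOps, hZ.fixed.r7, hZ.fixed.r4, hZ.fixed.r6, haddr, ht]
  omega

end Item

end RAM

namespace DKInstance

open RAM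

/-! ## The input -/

/-- All rows have length `m`, so skipping a row lowers the position by `m`. -/
theorem getD_flatten {α : Type*} {m : ℕ} {l : List (List α)} (hl : ∀ r ∈ l, r.length = m)
    {v j : ℕ} (hj : j < m) (x : α) :
    l.flatten.getD (j + v * m) x = (l.getD v []).getD j x := by
  induction l generalizing v with
  | nil => simp
  | cons r l ih =>
    have hr : r.length = m := hl r (by simp)
    cases v with
    | zero =>
      rw [Nat.zero_mul, Nat.add_zero, List.flatten_cons, List.getD_append _ _ _ _ (by omega),
        List.getD_cons_zero]
    | succ v =>
      rw [List.flatten_cons, List.getD_append_right _ _ _ _ (by rw [hr, Nat.succ_mul]; omega),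
        List.getD_cons_succ, ← ih (fun r hr => hl r (by simp [hr]))]
      congr 1
      rw [hr, Nat.succ_mul]
      omega

theorem getD_ofFn {α : Type*} {m : ℕ} (f : Fin m → α) (j : Fin m) (x : α) :
    (List.ofFn f).getD j x = f j := by
  simp [List.getD_eq_getElem?_getD]

theorem encode_eq (I : DKInstance) : I.encode = I.n :: I.m :: I.budget :: I.target ::
    (List.ofFn I.cost ++ (List.ofFn fun v => List.ofFn (I.util v)).flatten) := by
  simp [encode]

theorem costs_encode (I : DKInstance) (j : Fin I.m) : costs I.encode j = I.cost j := by
  rw [costs, encode_eq, Nat.add_comm]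
  simp only [List.getD_cons_succ]
  rw [List.getD_append _ _ _ _ (by simp), getD_ofFn]

theorem utils_encode (I : DKInstance) (v : Fin I.n) (j : Fin I.m) :
    utils I.encode I.m v j = I.util v j := by
  rw [utils, encode_eq, show 4 + (j : ℕ) + I.m + v * I.m = j + I.m + v * I.m + 4 by ring]
  simp only [List.getD_cons_succ]
  rw [List.getD_append_right _ _ _ _ (by simp; omega), List.length_ofFn,
    show (j : ℕ) + I.m + v * I.m - I.m = j + v * I.m by omega,
    getD_flatten (m := I.m) (by simp [List.mem_ofFn]) j.2, getD_ofFn, getD_ofFn]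

theorem sup_map_utils (I : DKInstance) (v : Fin I.n) (Z : Finset (Fin I.m)) :
    (Z.map Fin.valEmbedding).sup (utils I.encode I.m v) = I.sat v Z := by
  rw [sup_map, sat]
  exact sup_congr rfl fun p _ => utils_encode I v p

theorem exists_map_eq {m : ℕ} {Z : Finset ℕ} (hZ : Z ⊆ range m) :
    ∃ W : Finset (Fin m), W.map Fin.valEmbedding = Z := by
  refine ⟨univ.filter fun p : Fin m => (p : ℕ) ∈ Z, ?_⟩
  ext p
  simp only [mem_map, mem_filter, mem_univ, true_and, Fin.valEmbedding_apply]
  exact ⟨by rintro ⟨q, hq, rfl⟩; exact hq, fun hp => ⟨⟨p, mem_range.1 (hZ hp)⟩, hp, rfl⟩⟩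

theorem map_subset_range {m : ℕ} (W : Finset (Fin m)) : W.map Fin.valEmbedding ⊆ range m := by
  intro p hp
  obtain ⟨q, -, rfl⟩ := mem_map.1 hp
  exact mem_range.2 q.2

theorem sum_sup_utils (I : DKInstance) :
    ∑ v ∈ range I.n, (range I.m).sup (utils I.encode I.m v) = I.ubar := by
  rw [sum_range, ubar]
  refine sum_congr rfl fun v _ => ?_
  have : range I.m = (univ : Finset (Fin I.m)).map Fin.valEmbedding := by
    obtain ⟨W, hW⟩ := exists_map_eq (subset_refl (range I.m))
    exact subset_antisymm (hW ▸ map_subset_map.2 (subset_univ W)) (map_subset_range _)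
  rw [this, sup_map_utils, sat]

theorem isYes_iff (I : DKInstance) : I.IsYes ↔ I.target ≤
    best (costs I.encode) (utils I.encode I.m) I.n I.budget I.m (2 ^ I.n - 1) := by
  have hdiv : (2 ^ I.n - 1) / 2 ^ I.n = 0 :=
    Nat.div_eq_of_lt (Nat.sub_lt (by positivity) (by omega))
  have hbits : ({v ∈ range I.n | (2 ^ I.n - 1).testBit v} : Finset ℕ) = range I.n := by
    refine filter_true_of_mem fun v hv => ?_
    simpa using hv
  have hcost : ∀ Z : Finset (Fin I.m),
      ∑ p ∈ Z.map Fin.valEmbedding, costs I.encode p = ∑ p ∈ Z, I.cost p := by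
    intro Z
    rw [sum_map]
    exact sum_congr rfl fun p _ => costs_encode I p
  have hsat : ∀ Z : Finset (Fin I.m), ∑ v ∈ range I.n,
      (Z.map Fin.valEmbedding).sup (utils I.encode I.m v) = ∑ v, I.sat v Z := by
    intro Z
    rw [sum_range]
    exact sum_congr rfl fun v _ => sup_map_utils I v Z
  unfold best IsYes
  rw [hdiv, hbits]
  constructor
  · rintro ⟨Z, hc, hs⟩
    rw [← hsat] at hs
    refine hs.trans (le_sup (f := fun Z : Finset ℕ => ∑ v ∈ range I.n, Z.sup (utils I.encode I.m v)) ?_)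
    rw [bundles, mem_filter, mem_powerset, hcost]
    exact ⟨map_subset_range Z, by omega⟩
  · intro h
    obtain ⟨Z, hZ, e⟩ := exists_mem_eq_sup _ ⟨∅, empty_mem_bundles (Nat.zero_le _)⟩
      (fun Z : Finset ℕ => ∑ v ∈ range I.n, Z.sup (utils I.encode I.m v))
    rw [e] at h
    rw [bundles, mem_filter, mem_powerset] at hZ
    obtain ⟨W, rfl⟩ := exists_map_eq hZ.1
    rw [hcost] at hZ
    refine ⟨W, by omega, ?_⟩
    rw [← hsat]
    exact h

end DKInstance

/-! ### The polynomial bound -/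

open RAM DKInstance
/-- One RAM program decides every instance of Diverse Knapsack in at most
`2 ^ n * q(ū, b, n, m)` steps, for a fixed polynomial `q`. -/
theorem mainTheorem10 :
    ∃ (P : RAM.Program) (q : MvPolynomial (Fin 4) ℕ), ∀ I : DKInstance,
      RAM.DecidesWithin P I.encode I.IsYes
        (2 ^ I.n * MvPolynomial.eval ![I.ubar, I.budget, I.n, I.m] q) := by
  -- The running time does not involve `ū`; its factor serves only to bound the stored numbers. The
  -- constant `100` is generous.
  refine ⟨knapsackCom.code 0, 100 * (MvPolynomial.X 0 + 1) * (MvPolynomial.X 1 + 1) *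
    (MvPolynomial.X 2 + 1) * (MvPolynomial.X 3 + 1), fun I => ?_⟩
  have hT : 2 ^ I.n * MvPolynomial.eval ![I.ubar, I.budget, I.n, I.m]
      (100 * (MvPolynomial.X 0 + 1) * (MvPolynomial.X 1 + 1) *
        (MvPolynomial.X 2 + 1) * (MvPolynomial.X 3 + 1)) =
      100 * ((I.budget + 1) * 2 ^ I.n) * ((I.n + 1) * (I.m + 1)) * (I.ubar + 1) := by
    simp
    ring
  rw [hT]
  set L := (I.budget + 1) * 2 ^ I.n with hL
  set T := 100 * L * ((I.n + 1) * (I.m + 1)) * (I.ubar + 1) with hTdef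
  have hbL : I.budget + 1 ≤ L := Nat.le_mul_of_pos_right _ (by positivity)
  have hpoly : 100 * (L * I.n * I.m + L * I.n + L * I.m + L) ≤ T := by
    calc 100 * (L * I.n * I.m + L * I.n + L * I.m + L)
        = 100 * L * ((I.n + 1) * (I.m + 1)) * 1 := by ring
      _ ≤ T := Nat.mul_le_mul_left _ (by omega)
  have hubar : 2 * I.ubar ≤ T := by
    have : 1 ≤ L * ((I.n + 1) * (I.m + 1)) :=
      Nat.mul_pos (by omega) (by positivity)
    calc 2 * I.ubar ≤ 100 * 1 * (I.ubar + 1) := by omega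
      _ ≤ 100 * (L * ((I.n + 1) * (I.m + 1))) * (I.ubar + 1) := by gcongr
      _ = T := by rw [hTdef]; ring
  have hL1 : 1 ≤ L := by omega
  have hn : I.n ≤ L * I.n := Nat.le_mul_of_pos_left _ hL1
  have hm : I.m ≤ L * I.m := Nat.le_mul_of_pos_left _ hL1
  have hnm : I.n * I.m ≤ L * I.n * I.m := Nat.mul_le_mul_right _ hn
  have hE : Enough I.encode I.n I.m I.budget (max T (I.encode.foldr max 0)) := by
    refine ⟨fun i => le_max_of_le_right ?_, le_max_of_le_left (by omega),
      le_max_of_le_left (by rwa [sum_sup_utils]), le_max_of_le_left (by omega)⟩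
    generalize I.encode = l
    induction l generalizing i with
    | nil => simp
    | cons x l ih =>
      cases i with
      | zero => simp
      | succ i =>
        rw [List.getD_cons_succ, List.foldr_cons]
        exact le_max_of_le_right (ih i)
  have h0 : I.encode.getD 0 0 = I.n := by simp [encode]
  have h1 : I.encode.getD 1 0 = I.m := by simp [encode]
  have h2 : I.encode.getD 2 0 = I.budget := by simp [encode]
  have h3 : I.encode.getD 3 0 = I.target := by simp [encode]
  refine Run.decidesWithin ?_ ((run_knapsackCom hE h0 h1 h2).mono le_rfl fun X hX => ?_)
  · rw [← hL]
    have : I.m * (L * (19 * I.n + 21) + 11 * I.n + 19 + 2) =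
      19 * (L * I.n * I.m) + 21 * (L * I.m) + 11 * (I.n * I.m) + 21 * I.m := by ring
    omega
  · rw [h3] at hX
    rw [isYes_iff, hX]
    omega
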